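/- Let $C$ be a modular tensor category over $\mathbb{C}$: an abelian, semisimple, $\mathbb{C}$-linear ribbon category with bilinear tensor product $\boxtimes$, finite-dimensional morphism spaces, simple unit $1$ and finitely many isomorphism classes of simple objects (called labels), such that the matrix $s=(s_{ij})$ indexed by labels, where $s_{ij}$ is the quantum trace of the double braiding $\sigma_{ji}\sigma_{ij}$ of $i\boxtimes j$, is non-singular. Let $\theta$ be the twist and $\sigma$ the braiding. Let $V^-$ be an object with an isomorphism $\iota:V^-\boxtimes V^-\cong 1$ and $\theta_{V^-}=-1$ (so that $C$ is a pre-Clifford modular tensor category). For a label $i$ let $\bar i$ be the label of $V^-\boxtimes i$. A label $j$ is called NS if $\sigma_{V^-j}\sigma_{jV^-}=1$, and R if $\sigma_{V^-j}\sigma_{jV^-}=-1$. A non-split R label is a label $i$ with $\bar i=i$. Let $d$ be the quantum dimension of $V^-$. Then $d=\pm1$, and the following hold. (1) If $d=1$, then for all labels $i,j$ $$s_{\bar i j}=\begin{cases} s_{ij} & \text{if } j \text{ is NS},\\ -s_{ij} & \text{if } j \text{ is R.}\end{cases}$$ (If $d=-1$, the same holds with the two signs exchanged: $s_{\bar i j}=-s_{ij}$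 if $j$ is NS and $s_{\bar i j}=s_{ij}$ if $j$ is R.) (2) For either value of $d$, $s_{ij}=0$ whenever $i$ is a non-split R label and $j$ is R. -/

import Mathlib

open CategoryTheory MonoidalCategory

universe v u

namespace ModTens

/-- A ribbon structure on a rigid braided monoidal category: a twist that is compatible with the
tensor product and with duality. -/
class RibbonCategory (C : Type u) [Category.{v} C] [MonoidalCategory C] [BraidedCategory C]
    [RigidCategory C] where
  /-- the twist `θ`, a natural automorphism of the identity functor -/
  twist : 𝟭 C ≅ 𝟭 C
  twist_unit : twist.hom.app (𝟙_ C) = 𝟙 (𝟙_ C)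
  twist_tensor : ∀ X Y : C, twist.hom.app (X ⊗ Y) =
    (twist.hom.app X ⊗ₘ twist.hom.app Y) ≫ (β_ X Y).hom ≫ (β_ Y X).hom
  twist_dual : ∀ X : C, twist.hom.app (Xᘁ) = rightAdjointMate (twist.hom.app X : X ⟶ X)

section Trace

variable {C : Type u} [Category.{v} C] [MonoidalCategory C] [BraidedCategory C]
  [RigidCategory C] [RibbonCategory C]

/-- The twist `θ_X : X ⟶ X`. -/
def θ (X : C) : X ⟶ X := RibbonCategory.twist.hom.app X

/-- The quantum trace of an endomorphism, as an endomorphism of the unit object: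
create `X ⊗ X*`, apply `θ_X ∘ f` to `X`, braid to `X* ⊗ X`, and evaluate. -/
def traceHom {X : C} (f : X ⟶ X) : 𝟙_ C ⟶ 𝟙_ C :=
  η_ X Xᘁ ≫ (f ≫ θ X) ▷ Xᘁ ≫ (β_ X Xᘁ).hom ≫ ε_ X Xᘁ

end Trace

/-- Isomorphism, as an equivalence relation on simple objects. -/
def simpleSetoid (C : Type u) [Category.{v} C] [Limits.HasZeroMorphisms C] :
    Setoid {X : C // Simple X} where
  r X Y := Nonempty (X.1 ≅ Y.1)
  iseqv :=
    { refl := fun X => ⟨Iso.refl X.1⟩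
      symm := fun ⟨e⟩ => ⟨e.symm⟩
      trans := fun ⟨e⟩ ⟨f⟩ => ⟨e.trans f⟩ }

/-- The labels: isomorphism classes of simple (irreducible) objects. -/
def Label (C : Type u) [Category.{v} C] [Limits.HasZeroMorphisms C] : Type u :=
  Quotient (simpleSetoid C)

/-- A simple object representing a label. -/
noncomputable def Label.rep {C : Type u} [Category.{v} C] [Limits.HasZeroMorphisms C]
    (i : Label C) : C :=
  (Quotient.out (s := simpleSetoid C) i).1

/-- A semisimple `ℂ`-linear ribbon category with simple unit, finite-dimensional spaces of
morphisms, and finitely many isomorphism classes of simple objects. -/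
class PremodularCategory (C : Type u) [Category.{v} C] [Abelian C] [Linear ℂ C]
    [MonoidalCategory C] [MonoidalPreadditive C] [MonoidalLinear ℂ C] [BraidedCategory C]
    [RigidCategory C] [RibbonCategory C] : Prop where
  finiteDimensional_hom : ∀ X Y : C, FiniteDimensional ℂ (X ⟶ Y)
  simple_unit : Simple (𝟙_ C)
  semisimple : ∀ X : C, ∃ (n : ℕ) (f : Fin n → C),
    haveI : Limits.HasFiniteBiproducts C := Abelian.hasFiniteBiproducts
    (∀ k, Simple (f k)) ∧ Nonempty (X ≅ Limits.biproduct f)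
  finite_label : Finite (Label C)

section Premodular

variable {C : Type u} [Category.{v} C] [Abelian C] [Linear ℂ C]
  [MonoidalCategory C] [MonoidalPreadditive C] [MonoidalLinear ℂ C] [BraidedCategory C]
  [RigidCategory C] [RibbonCategory C] [PremodularCategory C]

theorem exists_unit_scalar (f : 𝟙_ C ⟶ 𝟙_ C) : ∃ c : ℂ, c • 𝟙 (𝟙_ C) = f :=
  haveI := PremodularCategory.simple_unit (C := C)
  haveI := PremodularCategory.finiteDimensional_hom (𝟙_ C) (𝟙_ C)
  endomorphism_simple_eq_smul_id ℂ f

/-- The complex number `c` with `f = c • 𝟙`, for an endomorphism `f` of the unit object. -/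
noncomputable def unitScalar (f : 𝟙_ C ⟶ 𝟙_ C) : ℂ := (exists_unit_scalar f).choose

/-- The quantum trace, as a complex number. -/
noncomputable def trace {X : C} (f : X ⟶ X) : ℂ := unitScalar (traceHom f)

/-- The quantum dimension. -/
noncomputable def qdim (X : C) : ℂ := trace (𝟙 X)

variable (C) in
/-- The `s`-matrix: `s i j` is the quantum trace of the double braiding of `i` and `j`. -/
noncomputable def sMatrix : Matrix (Label C) (Label C) ℂ := fun i j =>
  trace ((β_ i.rep j.rep).hom ≫ (β_ j.rep i.rep).hom)

end Premodular

open Classical in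
/-- A modular tensor category: a premodular category whose `s`-matrix is non-singular. -/
class ModularTensorCategory (C : Type u) [Category.{v} C] [Abelian C] [Linear ℂ C]
    [MonoidalCategory C] [MonoidalPreadditive C] [MonoidalLinear ℂ C] [BraidedCategory C]
    [RigidCategory C] [RibbonCategory C] : Prop extends PremodularCategory C where
  nonsingular : letI : Fintype (Label C) := @Fintype.ofFinite _ finite_label
    IsUnit (sMatrix C).det

/-- The additional data of a pre-Clifford modular tensor category. -/
structure PreClifford (C : Type u) [Category.{v} C] [Abelian C] [Linear ℂ C]
    [MonoidalCategory C] [MonoidalPreadditive C] [MonoidalLinear ℂ C] [BraidedCategory C]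
    [RigidCategory C] [RibbonCategory C] [ModularTensorCategory C] where
  /-- the object `V⁻` -/
  V : C
  ι : V ⊗ V ≅ 𝟙_ C
  twist_V : θ V = -𝟙 V

/-- If `V ⊗ V ≅ 1`, then `V ⊗ X` is simple for every simple `X`. -/
theorem simple_tensor {C : Type u} [Category.{v} C] [Limits.HasZeroMorphisms C]
    [MonoidalCategory C] {V : C} (ι : V ⊗ V ≅ 𝟙_ C) (X : C) [Simple X] : Simple (V ⊗ X) := by
  let e : 𝟭 C ≅ tensorLeft V ⋙ tensorLeft V :=
    NatIso.ofComponents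
      (fun Y => (λ_ Y).symm ≪≫ whiskerRightIso ι.symm Y ≪≫ α_ V V Y) (by
        intro Y Z f
        change f ≫ (λ_ Z).inv ≫ ι.inv ▷ Z ≫ (α_ V V Z).hom =
          ((λ_ Y).inv ≫ ι.inv ▷ Y ≫ (α_ V V Y).hom) ≫ V ◁ V ◁ f
        rw [leftUnitor_inv_naturality_assoc, whisker_exchange_assoc]
        simp)
  have : (tensorLeft V).IsEquivalence :=
    (CategoryTheory.Equivalence.mk (tensorLeft V) (tensorLeft V) e e.symm).isEquivalence_functor
  exact simple_obj (tensorLeft V) X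

namespace PreClifford

variable {C : Type u} [Category.{v} C] [Abelian C] [Linear ℂ C]
  [MonoidalCategory C] [MonoidalPreadditive C] [MonoidalLinear ℂ C] [BraidedCategory C]
  [RigidCategory C] [RibbonCategory C] [ModularTensorCategory C] (P : PreClifford C)

/-- The operation `i ↦ ī` on labels induced by `V⁻ ⊗ ?`. -/
def bar (i : Label C) : Label C :=
  Quotient.map (sa := simpleSetoid C) (sb := simpleSetoid C)
    (fun X => (⟨P.V ⊗ X.1, haveI := X.2; simple_tensor P.ι X.1⟩ : {X : C // Simple X}))
    (fun _ _ ⟨e⟩ => ⟨whiskerLeftIso P.V e⟩) i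

/-- The double braiding `ζ_M` of `M` with `V⁻`. -/
def ζ (M : C) : M ⊗ P.V ⟶ M ⊗ P.V := (β_ M P.V).hom ≫ (β_ P.V M).hom

/-- Neveu-Schwarz labels. -/
def IsNS (i : Label C) : Prop := P.ζ i.rep = 𝟙 (i.rep ⊗ P.V)

/-- Ramond labels. -/
def IsR (i : Label C) : Prop := P.ζ i.rep = -𝟙 (i.rep ⊗ P.V)

/-- Non-split R labels: the fixed points of `i ↦ ī`. -/
def IsNonSplitR (i : Label C) : Prop := P.bar i = i

end PreClifford

end ModTens

/-!
The proof is graphical calculus. A trace over `X ⊗ Y` is the trace over `X` of the partial trace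
over `Y` (`traceHom_tensor`); with cyclicity (`pairingTrace_comm`), which also shows that the trace
does not depend on the chosen duals, this is all that is needed about traces. It gives
`tr (X ◁ f) = tr f * qdim X` (`trace_whiskerLeft`), hence multiplicativity of `qdim`, and so
`d ^ 2 = qdim (V⁻ ⊗ V⁻) = qdim 1 = 1`.

If the double braiding of `j` with `V⁻` is a scalar `c`, the hexagon identities turn the double
braiding of `V⁻ ⊗ i` with `j` into `c` times `V⁻` tensored with the double braiding of `i` with `j`
(`doubleBraiding_tensor`). Taking traces, `s (bar i) j = c * d * s i j`, with `c = 1` for NS labels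
and `c = -1` for R labels.

Let `bar i = i` and let `j` be R. If `d = 1`, then `s i j = -s i j`. If `d = -1`, that relation is
empty, but `qdim i = d * qdim i` forces `qdim i = 0`. Since `i` is simple, the partial trace over
`j` of the double braiding is a multiple of the identity of `i`, so `s i j` is a multiple of
`qdim i`, and vanishes (`trace_eq_zero_of_qdim_eq_zero`).
-/

namespace ModTens

/-! ### Braid identities -/

section Braided

variable {C : Type u} [Category.{v} C] [MonoidalCategory C] [BraidedCategory C]

/-- A strand passes behind a cap: braiding `X` past `A` and `B` and then applying
`h : A ⊗ B ⟶ 𝟙_ C` is the same as applying `h` at once. -/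
theorem braiding_braiding_cap (X : C) {A B : C} (h : A ⊗ B ⟶ 𝟙_ C) :
    (β_ X A).hom ▷ B ⊗≫ A ◁ (β_ X B).hom ⊗≫ h ▷ X = 𝟙 _ ⊗≫ X ◁ h ⊗≫ 𝟙 _ := by
  have key : (β_ X (A ⊗ B)).hom ≫ h ▷ X = X ◁ h ≫ (β_ X (𝟙_ C)).hom :=
    (BraidedCategory.braiding_naturality_right X h).symm
  rw [BraidedCategory.braiding_tensor_right_hom, braiding_tensorUnit_right] at key
  calc
    _ = 𝟙 _ ⊗≫ (((α_ X A B).inv ≫ (β_ X A).hom ▷ B ≫ (α_ A X B).hom ≫ A ◁ (β_ X B).hom ≫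
          (α_ A B X).inv) ≫ h ▷ X) := by monoidal
    _ = _ := by rw [key]; monoidal

/-- Untangling the full twist of `X` and `Y` against the braiding past the dual of `X ⊗ Y`: what
remains is two nested caps. By naturality the crossing `β_ Y X` slides through the braiding past
`E ⊗ D`. There `Y` crosses the cap `ε_ X D`, and once it is pulled off, `X` crosses only the cap
`(β_ Y E).hom ≫ ε_ Y E`, so that `braiding_braiding_cap` removes both. -/
theorem braiding_evaluation_tensor (X Y D E : C) [ExactPairing X D] [ExactPairing Y E] :
    ((β_ X Y).hom ≫ (β_ Y X).hom) ▷ (E ⊗ D) ≫ (β_ (X ⊗ Y) (E ⊗ D)).hom ≫ ε_ (X ⊗ Y) (E ⊗ D) =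
      𝟙 _ ⊗≫ X ◁ ((β_ Y E).hom ≫ ε_ Y E) ▷ D ⊗≫ (β_ X D).hom ≫ ε_ X D := by
  calc
    _ = (β_ X Y).hom ▷ (E ⊗ D) ≫ (β_ (Y ⊗ X) (E ⊗ D)).hom ≫ (E ⊗ D) ◁ (β_ Y X).hom ≫
          ε_ (X ⊗ Y) (E ⊗ D) := by
      rw [comp_whiskerRight, Category.assoc, BraidedCategory.braiding_naturality_left_assoc]
    _ = 𝟙 _ ⊗≫ (β_ X Y).hom ▷ (E ⊗ D) ⊗≫ Y ◁ (β_ X E).hom ▷ D ⊗≫ Y ◁ E ◁ (β_ X D).hom ⊗≫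
          (β_ Y E).hom ▷ (D ⊗ X) ⊗≫
          E ◁ ((β_ Y D).hom ▷ X ⊗≫ D ◁ (β_ Y X).hom ⊗≫ ε_ X D ▷ Y) ⊗≫ ε_ Y E := by
      rw [ExactPairing.tensor_evaluation, BraidedCategory.braiding_tensor_left_hom,
        BraidedCategory.braiding_tensor_right_hom, BraidedCategory.braiding_tensor_right_hom]
      monoidal
    _ = 𝟙 _ ⊗≫ (β_ X Y).hom ▷ (E ⊗ D) ⊗≫ Y ◁ (β_ X E).hom ▷ D ⊗≫ Y ◁ E ◁ (β_ X D).hom ⊗≫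
          ((β_ Y E).hom ▷ (D ⊗ X) ≫ (E ⊗ Y) ◁ ε_ X D) ⊗≫ ε_ Y E := by
      rw [braiding_braiding_cap]; monoidal
    _ = 𝟙 _ ⊗≫ (β_ X Y).hom ▷ (E ⊗ D) ⊗≫ Y ◁ (β_ X E).hom ▷ D ⊗≫
          ((Y ⊗ E) ◁ ((β_ X D).hom ≫ ε_ X D) ≫ ((β_ Y E).hom ≫ ε_ Y E) ▷ 𝟙_ C) ⊗≫ 𝟙 _ := by
      rw [← whisker_exchange]; monoidal
    _ = 𝟙 _ ⊗≫ ((β_ X Y).hom ▷ E ⊗≫ Y ◁ (β_ X E).hom ⊗≫ ((β_ Y E).hom ≫ ε_ Y E) ▷ X) ▷ D ⊗≫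
          (β_ X D).hom ≫ ε_ X D := by
      rw [whisker_exchange]; monoidal
    _ = _ := by rw [braiding_braiding_cap]; monoidal

/-- The double braiding with `V ⊗ X`, when the double braiding with `V` is a scalar. -/
theorem doubleBraiding_tensor [Preadditive C] [Linear ℂ C] [MonoidalPreadditive C]
    [MonoidalLinear ℂ C] {V X Y : C} {c : ℂ}
    (h : (β_ Y V).hom ≫ (β_ V Y).hom = c • 𝟙 (Y ⊗ V)) :
    (β_ (V ⊗ X) Y).hom ≫ (β_ Y (V ⊗ X)).hom =
      c • ((α_ V X Y).hom ≫ V ◁ ((β_ X Y).hom ≫ (β_ Y X).hom) ≫ (α_ V X Y).inv) := by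
  have h' : (β_ V Y).hom ≫ (β_ Y V).hom = c • 𝟙 (V ⊗ Y) := by
    rw [← cancel_epi (β_ Y V).hom, ← Category.assoc, h]
    simp
  rw [BraidedCategory.braiding_tensor_left_hom, BraidedCategory.braiding_tensor_right_hom]
  simp only [Category.assoc, Iso.hom_inv_id_assoc]
  rw [← comp_whiskerRight_assoc, h']
  simp [MonoidalLinear.smul_whiskerRight]

end Braided

/-! ### Partial traces in a ribbon category -/

section Ribbon

variable {C : Type u} [Category.{v} C] [MonoidalCategory C] [BraidedCategory C]
  [RigidCategory C] [RibbonCategory C]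

theorem θ_naturality {X Y : C} (f : X ⟶ Y) : f ≫ θ Y = θ X ≫ f :=
  (RibbonCategory.twist (C := C)).hom.naturality f

theorem θ_unit : θ (𝟙_ C) = 𝟙 (𝟙_ C) := RibbonCategory.twist_unit

theorem θ_tensor (X Y : C) :
    θ (X ⊗ Y) = (θ X ⊗ₘ θ Y) ≫ (β_ X Y).hom ≫ (β_ Y X).hom :=
  RibbonCategory.twist_tensor X Y

/-- The evaluation `X ⊗ D ⟶ 𝟙_ C` on the other side, for any right dual `D` of `X`: twist `X`,
braid it past `D`, and evaluate. -/
def twistedEval (X D : C) [ExactPairing X D] : X ⊗ D ⟶ 𝟙_ C :=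
  θ X ▷ D ≫ (β_ X D).hom ≫ ε_ X D

/-- The quantum trace of `f` computed with an arbitrary right dual `D` of `X`. -/
def pairingTrace {X : C} (D : C) [ExactPairing X D] (f : X ⟶ X) : 𝟙_ C ⟶ 𝟙_ C :=
  η_ X D ≫ f ▷ D ≫ twistedEval X D

/-- The partial quantum trace over the second factor of an endomorphism of `X ⊗ Y`. -/
def partialTrace {X Y : C} (E : C) [ExactPairing Y E] (f : X ⊗ Y ⟶ X ⊗ Y) : X ⟶ X :=
  𝟙 _ ⊗≫ X ◁ η_ Y E ⊗≫ f ▷ E ⊗≫ X ◁ twistedEval Y E ⊗≫ 𝟙 _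

/-- Cyclicity of the trace. The two sides may use different right duals, so that with `g = 𝟙` this
also says that `pairingTrace` does not depend on the choice of the dual. The mate of `f` carries `f`
around the loop. -/
theorem pairingTrace_comm {X Y : C} (D E : C) [ExactPairing X D] [ExactPairing Y E]
    (f : X ⟶ Y) (g : Y ⟶ X) : pairingTrace D (f ≫ g) = pairingTrace E (g ≫ f) := by
  let : HasRightDual X := ⟨D⟩
  let : HasRightDual Y := ⟨E⟩
  let m : E ⟶ D := rightAdjointMate f
  have hη : η_ X D ≫ f ▷ D = η_ Y E ≫ Y ◁ m := (coevaluation_comp_rightAdjointMate f).symm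
  have hε : m ▷ X ≫ ε_ X D = E ◁ f ≫ ε_ Y E := rightAdjointMate_comp_evaluation f
  calc
    _ = (η_ X D ≫ f ▷ D) ≫ (g ≫ θ X) ▷ D ≫ (β_ X D).hom ≫ ε_ X D := by
      simp [pairingTrace, twistedEval]
    _ = η_ Y E ≫ (g ≫ θ X) ▷ E ≫ (β_ X E).hom ≫ m ▷ X ≫ ε_ X D := by
      rw [hη, Category.assoc, whisker_exchange_assoc,
        BraidedCategory.braiding_naturality_right_assoc]
    _ = η_ Y E ≫ ((g ≫ θ X) ≫ f) ▷ E ≫ (β_ Y E).hom ≫ ε_ Y E := by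
      rw [hε, ← BraidedCategory.braiding_naturality_left_assoc, comp_whiskerRight _ f,
        Category.assoc]
    _ = _ := by
      rw [Category.assoc, ← θ_naturality]; simp [pairingTrace, twistedEval]

theorem traceHom_eq_pairingTrace {X : C} (D : C) [ExactPairing X D] (f : X ⟶ X) :
    traceHom f = pairingTrace D f := by
  have h : traceHom f = pairingTrace Xᘁ f := by simp [traceHom, pairingTrace, twistedEval]
  rw [h]
  simpa only [Category.comp_id, Category.id_comp] using pairingTrace_comm Xᘁ D f (𝟙 X)

/-- The evaluation of `X ⊗ Y` on the other side is the nested one. The double braiding in `θ_tensor`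
is exactly what untangles the braiding of `X ⊗ Y` past its dual. -/
theorem twistedEval_tensor (X Y D E : C) [ExactPairing X D] [ExactPairing Y E] :
    twistedEval (X ⊗ Y) (E ⊗ D) = 𝟙 _ ⊗≫ X ◁ twistedEval Y E ▷ D ⊗≫ twistedEval X D := by
  calc
    _ = (θ X ⊗ₘ θ Y) ▷ (E ⊗ D) ≫ ((β_ X Y).hom ≫ (β_ Y X).hom) ▷ (E ⊗ D) ≫
          (β_ (X ⊗ Y) (E ⊗ D)).hom ≫ ε_ (X ⊗ Y) (E ⊗ D) := by
      rw [twistedEval, θ_tensor, comp_whiskerRight, Category.assoc]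
    _ = 𝟙 _ ⊗≫ X ◁ θ Y ▷ (E ⊗ D) ⊗≫
          (θ X ▷ (Y ⊗ E) ≫ X ◁ ((β_ Y E).hom ≫ ε_ Y E)) ▷ D ⊗≫ (β_ X D).hom ≫ ε_ X D := by
      rw [braiding_evaluation_tensor, tensorHom_def']; monoidal
    _ = _ := by
      rw [← whisker_exchange, twistedEval, twistedEval]; monoidal

/-- The trace on `X ⊗ Y` is the trace on `X` of the partial trace over `Y`. -/
theorem pairingTrace_tensor {X Y : C} (D E : C) [ExactPairing X D] [ExactPairing Y E]
    (f : X ⊗ Y ⟶ X ⊗ Y) :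
    pairingTrace (E ⊗ D) f = pairingTrace D (partialTrace E f) := by
  rw [pairingTrace, twistedEval_tensor, ExactPairing.tensor_coevaluation, pairingTrace,
    partialTrace]
  monoidal

/-- Up to unitors, the partial trace of `X ◁ f` is `X` tensored with the trace of `f`. -/
theorem partialTrace_whiskerLeft (X : C) {Y : C} (E : C) [ExactPairing Y E] (f : Y ⟶ Y) :
    partialTrace E (X ◁ f) = 𝟙 _ ⊗≫ X ◁ pairingTrace E f ⊗≫ 𝟙 _ := by
  rw [partialTrace, pairingTrace]
  monoidal

theorem traceHom_comm {X Y : C} (f : X ⟶ Y) (g : Y ⟶ X) : traceHom (f ≫ g) = traceHom (g ≫ f) := by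
  rw [traceHom_eq_pairingTrace Xᘁ, traceHom_eq_pairingTrace Yᘁ, pairingTrace_comm Xᘁ Yᘁ]

theorem traceHom_tensor {X Y : C} (f : X ⊗ Y ⟶ X ⊗ Y) :
    traceHom f = traceHom (partialTrace Yᘁ f) := by
  rw [traceHom_eq_pairingTrace (Yᘁ ⊗ Xᘁ), traceHom_eq_pairingTrace Xᘁ, pairingTrace_tensor Xᘁ Yᘁ]

theorem traceHom_id_unit : traceHom (𝟙 (𝟙_ C)) = 𝟙 (𝟙_ C) := by
  have hη : η_ (𝟙_ C) (𝟙_ C) = (ρ_ (𝟙_ C)).inv := rfl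
  have hε : ε_ (𝟙_ C) (𝟙_ C) = (ρ_ (𝟙_ C)).hom := rfl
  rw [traceHom_eq_pairingTrace (𝟙_ C), pairingTrace, twistedEval, θ_unit, hη, hε]
  simp only [Category.id_comp, id_whiskerRight, braiding_tensorUnit_left, Category.assoc,
    Iso.inv_hom_id, Category.comp_id, unitors_equal]

end Ribbon

/-! ### Numerical traces and the double braiding -/

theorem Label.simple_rep {C : Type u} [Category.{v} C] [Limits.HasZeroMorphisms C]
    (i : Label C) : Simple i.rep :=
  (Quotient.out (s := simpleSetoid C) i).2

section Premodular

variable {C : Type u} [Category.{v} C] [Abelian C] [Linear ℂ C]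
  [MonoidalCategory C] [MonoidalPreadditive C] [MonoidalLinear ℂ C] [BraidedCategory C]
  [RigidCategory C] [RibbonCategory C] [PremodularCategory C]

theorem unitScalar_smul (f : 𝟙_ C ⟶ 𝟙_ C) : unitScalar f • 𝟙 (𝟙_ C) = f :=
  (exists_unit_scalar f).choose_spec

theorem unitScalar_eq {f : 𝟙_ C ⟶ 𝟙_ C} {c : ℂ} (h : f = c • 𝟙 (𝟙_ C)) : unitScalar f = c := by
  have := PremodularCategory.simple_unit (C := C)
  exact smul_left_injective ℂ (id_nonzero (𝟙_ C)) ((unitScalar_smul f).trans h)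

theorem trace_smul {X : C} (c : ℂ) (f : X ⟶ X) : trace (c • f) = c * trace f := by
  refine unitScalar_eq ?_
  rw [mul_smul, trace, unitScalar_smul]
  simp [traceHom]

theorem trace_comm {X Y : C} (f : X ⟶ Y) (g : Y ⟶ X) : trace (f ≫ g) = trace (g ≫ f) := by
  rw [trace, traceHom_comm, trace]

theorem trace_conj {X Y : C} (e : X ≅ Y) (f : Y ⟶ Y) : trace (e.hom ≫ f ≫ e.inv) = trace f := by
  rw [trace_comm]; simp

theorem qdim_congr {X Y : C} (e : X ≅ Y) : qdim X = qdim Y := by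
  rw [qdim, qdim, ← trace_conj e]; simp

theorem qdim_unit : qdim (𝟙_ C) = 1 :=
  unitScalar_eq (by rw [traceHom_id_unit, one_smul])

theorem trace_whiskerLeft (X : C) {Y : C} (f : Y ⟶ Y) : trace (X ◁ f) = trace f * qdim X := by
  have h : partialTrace Yᘁ (X ◁ f) = trace f • 𝟙 X := by
    rw [partialTrace_whiskerLeft, ← traceHom_eq_pairingTrace Yᘁ, ← unitScalar_smul (traceHom f)]
    simp [monoidalComp, trace]
  rw [trace, traceHom_tensor, h]
  exact trace_smul _ _

theorem qdim_tensor (X Y : C) : qdim (X ⊗ Y) = qdim Y * qdim X := by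
  rw [qdim, ← whiskerLeft_id, trace_whiskerLeft]
  rfl

/-- The partial trace over `Y` is a scalar `c` by Schur's lemma, so the full trace is
`c * qdim X`. -/
theorem trace_eq_zero_of_qdim_eq_zero {X Y : C} [Simple X] (hX : qdim X = 0)
    (f : X ⊗ Y ⟶ X ⊗ Y) : trace f = 0 := by
  have := PremodularCategory.finiteDimensional_hom X X
  obtain ⟨c, hc⟩ := endomorphism_simple_eq_smul_id ℂ (partialTrace Yᘁ f)
  rw [trace, traceHom_tensor, ← hc]
  change trace _ = 0
  rw [trace_smul, ← qdim, hX, mul_zero]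

theorem trace_doubleBraiding_tensor {V X Y : C} {c : ℂ}
    (h : (β_ Y V).hom ≫ (β_ V Y).hom = c • 𝟙 (Y ⊗ V)) :
    trace ((β_ (V ⊗ X) Y).hom ≫ (β_ Y (V ⊗ X)).hom) =
      c * qdim V * trace ((β_ X Y).hom ≫ (β_ Y X).hom) := by
  rw [doubleBraiding_tensor h, trace_smul, trace_conj, trace_whiskerLeft]
  ring

theorem trace_doubleBraiding_congr {X X' : C} (e : X ≅ X') (Y : C) :
    trace ((β_ X Y).hom ≫ (β_ Y X).hom) = trace ((β_ X' Y).hom ≫ (β_ Y X').hom) := by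
  rw [← trace_conj (whiskerRightIso e Y)]
  congr 1
  simp [← BraidedCategory.braiding_naturality_right]

end Premodular

/-! ### Tensoring with `V⁻` -/

namespace PreClifford

variable {C : Type u} [Category.{v} C] [Abelian C] [Linear ℂ C]
  [MonoidalCategory C] [MonoidalPreadditive C] [MonoidalLinear ℂ C] [BraidedCategory C]
  [RigidCategory C] [RibbonCategory C] [ModularTensorCategory C] (P : PreClifford C)

theorem nonempty_bar_rep_iso (i : Label C) : Nonempty ((P.bar i).rep ≅ P.V ⊗ i.rep) := by
  let x := Quotient.out (s := simpleSetoid C) i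
  have hx : (Quotient.mk (simpleSetoid C) x : Label C) = i :=
    Quotient.out_eq (s := simpleSetoid C) i
  have h : P.bar i = Quotient.mk (simpleSetoid C)
      ⟨P.V ⊗ x.1, haveI := x.2; simple_tensor P.ι x.1⟩ := by
    conv_lhs => rw [← hx]
    rfl
  rw [h]
  exact Quotient.mk_out (s := simpleSetoid C) _

theorem qdim_V_mul_self : qdim P.V * qdim P.V = 1 := by
  rw [← qdim_tensor, qdim_congr P.ι, qdim_unit]

theorem sMatrix_bar {c : ℂ} (i : Label C) {j : Label C}
    (h : P.ζ j.rep = c • 𝟙 (j.rep ⊗ P.V)) :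
    sMatrix C (P.bar i) j = c * qdim P.V * sMatrix C i j := by
  obtain ⟨e⟩ := P.nonempty_bar_rep_iso i
  rw [sMatrix, trace_doubleBraiding_congr e, trace_doubleBraiding_tensor h, sMatrix]

theorem sMatrix_bar_of_isNS (i : Label C) {j : Label C} (h : P.IsNS j) :
    sMatrix C (P.bar i) j = qdim P.V * sMatrix C i j := by
  rw [P.sMatrix_bar i (c := 1) (by rw [one_smul]; exact h), one_mul]

theorem sMatrix_bar_of_isR (i : Label C) {j : Label C} (h : P.IsR j) :
    sMatrix C (P.bar i) j = -(qdim P.V * sMatrix C i j) := by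
  rw [P.sMatrix_bar i (c := -1) (by rw [neg_one_smul]; exact h), neg_one_mul, neg_mul]

/-- If `d = -1`, a fixed point `i` of the bar operation has quantum dimension `0`, since
`qdim i = d * qdim i`. -/
theorem sMatrix_eq_zero_of_bar_eq {i : Label C} (hd : qdim P.V = -1) (hi : P.bar i = i)
    (j : Label C) : sMatrix C i j = 0 := by
  obtain ⟨e⟩ := P.nonempty_bar_rep_iso i
  have := i.simple_rep
  have h := qdim_congr e
  rw [hi, qdim_tensor, hd, mul_neg_one] at h
  exact trace_eq_zero_of_qdim_eq_zero (self_eq_neg.mp h) _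

end PreClifford

end ModTens

theorem mainTheorem6 {C : Type u} [Category.{v} C] [Abelian C] [Linear ℂ C]
    [MonoidalCategory C] [MonoidalPreadditive C] [MonoidalLinear ℂ C] [BraidedCategory C]
    [RigidCategory C] [ModTens.RibbonCategory C] [ModTens.ModularTensorCategory C]
    (P : ModTens.PreClifford C) :
    (ModTens.qdim P.V = 1 ∨ ModTens.qdim P.V = -1) ∧
    (ModTens.qdim P.V = 1 → ∀ i j : ModTens.Label C,
      (P.IsNS j → ModTens.sMatrix C (P.bar i) j = ModTens.sMatrix C i j) ∧
      (P.IsR j → ModTens.sMatrix C (P.bar i) j = -ModTens.sMatrix C i j)) ∧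
    (ModTens.qdim P.V = -1 → ∀ i j : ModTens.Label C,
      (P.IsNS j → ModTens.sMatrix C (P.bar i) j = -ModTens.sMatrix C i j) ∧
      (P.IsR j → ModTens.sMatrix C (P.bar i) j = ModTens.sMatrix C i j)) ∧
    (∀ i j : ModTens.Label C,
      P.IsNonSplitR i → P.IsR j → ModTens.sMatrix C i j = 0) := by
  have hs := mul_self_eq_one_iff.mp P.qdim_V_mul_self
  refine ⟨hs, fun hd i j => ⟨fun hj => ?_, fun hj => ?_⟩,
    fun hd i j => ⟨fun hj => ?_, fun hj => ?_⟩, fun i j hi hj => ?_⟩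
  · rw [P.sMatrix_bar_of_isNS i hj, hd, one_mul]
  · rw [P.sMatrix_bar_of_isR i hj, hd, one_mul]
  · rw [P.sMatrix_bar_of_isNS i hj, hd, neg_one_mul]
  · rw [P.sMatrix_bar_of_isR i hj, hd, neg_one_mul, neg_neg]
  · rcases hs with hd | hd
    · have h := P.sMatrix_bar_of_isR i hj
      rw [show P.bar i = i from hi, hd, one_mul] at h
      exact self_eq_neg.mp h
    · exact P.sMatrix_eq_zero_of_bar_eq hd hi j
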